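/- Let $\mathbb K$ be an algebraically closed field of arbitrary characteristic, let $n\ge 0$, $m\ge 1$ be integers, let $f\in\mathbb K[x_1,\ldots,x_s]$ be an irreducible polynomial, $A=\mathbb K[x_1,\ldots,x_s]/\langle f\rangle$, and let $X=\mathbf V(f)=\operatorname{Spec}A\subset\mathbb A^s_{\mathbb K}$ be the corresponding irreducible hypersurface. Let $A_n=\operatorname{HS}^n_{A/\mathbb K}$ be the Hasse--Schmidt algebra of order $n$ of $A$ over $\mathbb K$, that is, the quotient of the polynomial $A$-algebra on symbols $a^{(i)}$ ($a\in A$, $1\le i\le n$) by the relations $(a+b)^{(i)}=a^{(i)}+b^{(i)}$ and $\lambda^{(i)}=0$ for $1\le i\le n$, and $(ab)^{(i)}=\sum_{j+k=i}a^{(j)}b^{(k)}$ for $0\le i\le n$ ($a,b\in A$, $\lambda\in\mathbb K$, with $a^{(0)}=a$). Write $d_i(a)=a^{(i)}$ for the universal Hasse--Schmidt derivation, and let $J_n(X)=\operatorname{Spec}A_n$ be the $n$-th jet scheme of $X$, which is a closed subscheme of $\mathbb A^{s(n+1)}_{\mathbb K}$ through the coordinates $x_i^{(j)}$. Let $$\operatorname{Jac}_m(f)=\Big(\tfrac{1}{(\alpha-\beta)!}\tfrac{\partial^{\alpha-\beta}f}{\partial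 x^{\alpha-\beta}}\Big)_{\beta,\alpha}$$ be the Jacobian matrix of order $m$ of $f$, with rows indexed by the $\beta\in\mathbb N^s$ with $0\le|\beta|\le m-1$ and columns by the $\alpha\in\mathbb N^s$ with $1\le|\alpha|\le m$; here $\frac1{\delta!}\frac{\partial^{\delta}}{\partial x^{\delta}}$ is the divided partial derivative $x^\gamma\mapsto\prod_i\binom{\gamma_i}{\delta_i}\,x^{\gamma-\delta}$, and an entry is $0$ if $\alpha_i<\beta_i$ for some $i$. The number of rows is $M=\binom{m+s-1}{s}$. Let $D_n(\operatorname{Jac}_m(f))$ be the $(n+1)\times(n+1)$ block matrix over $A_n$ whose block in position $(i,j)$, $0\le i,j\le n$, is $d_{j-i}(\operatorname{Jac}_m(f))$ (with $d_{j-i}$ applied to the class in $A$ of each entry) if $i\le j$, and $0$ if $i>j$. Assume that $J_n(X)$ is irreducible, and let $p=(x_1,\ldots,x_s,x_1^{(1)},\ldots,x_s^{(1)},\ldots,x_1^{(n)},\ldots,x_s^{(n)})$ be a $\mathbb K$-point of $J_n(X)$. Then $p$ is a non-singular point of $J_n(X)$ (that is, the local ring of $J_n(X)$ at $p$ is regular)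 if and only if the matrix $D_n(\operatorname{Jac}_m(f))$ evaluated at $p$ satisfies $$\operatorname{rank}\big(D_n(\operatorname{Jac}_m(f))|_p\big)=(n+1)M.$$ -/

import Mathlib

noncomputable section

namespace JetJac

open Finset

section HasseSchmidt

variable (K A : Type*) [CommRing K] [CommRing A] [Algebra K A] (n : ℕ)

/-- The symbol `x^{(i)}` in the polynomial algebra `A[x^{(i)} | x ∈ A, i = 1, …, n]`.
The variable indexed by `(x, j)`, `j = 0, …, n - 1`, stands for `x^{(j + 1)}`, and `x^{(0)}` is
the constant `x`. Orders above `n` do not occur; the symbol is `0` there. -/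
def symb (x : A) : ℕ → MvPolynomial (A × Fin n) A
  | 0 => MvPolynomial.C x
  | j + 1 => if h : j < n then MvPolynomial.X (x, ⟨j, h⟩) else 0

/-- The ideal of relations of the Hasse-Schmidt algebra of order `n`: additivity, triviality on
the scalars, and the Leibniz rule. -/
def hsIdeal : Ideal (MvPolynomial (A × Fin n) A) :=
  Ideal.span
    ({P | ∃ x y : A, ∃ i : ℕ, 1 ≤ i ∧ i ≤ n ∧
        P = symb A n (x + y) i - symb A n x i - symb A n y i} ∪
     {P | ∃ c : K, ∃ i : ℕ, 1 ≤ i ∧ i ≤ n ∧ P = symb A n (algebraMap K A c) i} ∪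
     {P | ∃ x y : A, ∃ i : ℕ, i ≤ n ∧
        P = symb A n (x * y) i - ∑ jk ∈ HasAntidiagonal.antidiagonal i, symb A n x jk.1 * symb A n y jk.2})

/-- The Hasse-Schmidt algebra `HS^n_{A/K}`, whose spectrum is the `n`-th jet scheme of
`Spec A` over `K`. -/
abbrev HSAlg : Type _ := MvPolynomial (A × Fin n) A ⧸ hsIdeal K A n

/-- The components `d_i : A → HS^n_{A/K}` (`i = 0, …, n`) of the universal Hasse-Schmidt
derivation. -/
def hsd (i : ℕ) (x : A) : HSAlg K A n := Ideal.Quotient.mk (hsIdeal K A n) (symb A n x i)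

/-- The block upper triangular matrix `D_n(L)`, whose block in position `(i, j)`, with
`0 ≤ i, j ≤ n`, is `d_{j-i}(L)` if `i ≤ j` and `0` otherwise. -/
def jetMatrix {ι κ : Type*} (L : Matrix ι κ A) :
    Matrix (Fin (n + 1) × ι) (Fin (n + 1) × κ) (HSAlg K A n) :=
  fun a b => if a.1 ≤ b.1 then hsd K A n ((b.1 : ℕ) - (a.1 : ℕ)) (L a.2 b.2) else 0

end HasseSchmidt

section HigherJacobian

variable {K : Type*} [CommRing K] {s : ℕ}

/-- The divided partial derivative `(1/δ!) ∂^δ f / ∂x^δ`, which makes sense in every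
characteristic: it sends `x^γ` to `∏ i, (γ i choose δ i) * x^(γ - δ)`, so to `0` unless `δ ≤ γ`. -/
def dividedDeriv (δ : Fin s →₀ ℕ) (f : MvPolynomial (Fin s) K) : MvPolynomial (Fin s) K :=
  ∑ γ ∈ f.support,
    MvPolynomial.monomial (γ - δ) (((∏ i, (γ i).choose (δ i) : ℕ) : K) * f.coeff γ)

/-- The finite set of the multi-indices `β` with `0 ≤ |β| ≤ m - 1` (row indices). -/
def rowIdx (s m : ℕ) : Finset (Fin s →₀ ℕ) :=
  (range m).biUnion fun k => finsuppAntidiag univ k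

/-- The finite set of the multi-indices `α` with `1 ≤ |α| ≤ m` (column indices). -/
def colIdx (s m : ℕ) : Finset (Fin s →₀ ℕ) :=
  (Icc 1 m).biUnion fun k => finsuppAntidiag univ k

/-- The Jacobian matrix `Jac_m(f)` of order `m` of a polynomial `f`. -/
def higherJac (m : ℕ) (f : MvPolynomial (Fin s) K) :
    Matrix (rowIdx s m) (colIdx s m) (MvPolynomial (Fin s) K) :=
  fun β α =>
    if (β : Fin s →₀ ℕ) ≤ (α : Fin s →₀ ℕ) then
      dividedDeriv ((α : Fin s →₀ ℕ) - (β : Fin s →₀ ℕ)) f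
    else 0

end HigherJacobian

section Hypersurface

variable {K : Type*} [Field K] {s : ℕ}

/-- The coordinate ring `K[x_1, …, x_s]/⟨f⟩` of the hypersurface `V(f)`. -/
abbrev CoordRing (f : MvPolynomial (Fin s) K) : Type _ :=
  MvPolynomial (Fin s) K ⧸ Ideal.span {f}

/-- The coordinate ring of the `n`-th jet scheme `J_n(V(f))` over `K`. -/
abbrev JetRing (f : MvPolynomial (Fin s) K) (n : ℕ) : Type _ := HSAlg K (CoordRing f) n

/-- The matrix `D_n(Jac_m(f))`, with entries in the coordinate ring of `J_n(V(f))`. -/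
def jetHigherJac (f : MvPolynomial (Fin s) K) (n m : ℕ) :
    Matrix (Fin (n + 1) × rowIdx s m) (Fin (n + 1) × colIdx s m) (JetRing f n) :=
  jetMatrix K (CoordRing f) n ((higherJac m f).map (Ideal.Quotient.mk (Ideal.span {f})))

/-- A `K`-point `p` of an affine `K`-scheme `Spec R`, that is, evaluation at `p`, is non-singular
if the local ring of `Spec R` at `p` is a regular local ring. -/
def IsNonsingularPoint {R : Type*} [CommRing R] [Algebra K R] (p : R →ₐ[K] K) : Prop :=
  haveI : (RingHom.ker p).IsPrime := RingHom.ker_isPrime p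
  IsRegularLocalRing (Localization.AtPrime (RingHom.ker p))

end Hypersurface

end JetJac

end

/-! Both conditions say that the gradient of `f` does not vanish at the base point of the jet `p`.

Rank: the diagonal blocks of the matrix at `p` are all `Jac_m(f)` at the base point, where `f`
itself vanishes. If all `∂_k f` vanish there too, the rows of the last block with `|β| = m - 1` are
zero, since only derivatives of order at most 1 reach them. If `∂_k f ≠ 0`, the columns `(a, β +
e_k)` give a square submatrix, triangular for the lexicographic order of `(a, |β|, |β| - β_k)`, with
`∂_k f` on the diagonal.

Regularity: `J_n(X)` is cut out by the coefficients `F_0, …, F_n` of `f(∑ x^{(j)} t^j)`. For `j ≥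
1`, `F_j` is affine in `x_k^{(j)}` with slope `∂_k f(x^{(0)})`, modulo earlier variables
(`jetCoeff_sub_mem`). If this slope is nonzero at `p`, every `x_k^{(j)}` can be dropped from the
generators of the maximal ideal (`sub_mem_span_of_pderiv_ne_zero`). This leaves `(s-1)(n+1)` of
them, and by Krull's height theorem the dimension is at least that.

If the gradient vanishes, so does the differential of `F_0` at `p`, and the embedding dimension is
at least `s(n+1) - n` (`card_le_spanFinrank_add`). But `dim J_n(X) ≤ (s-1)(n+1)`: as `K` is perfect,
`f` fails to divide some `∂_k f`, which is then not nilpotent on `J_n(X)` (test it on constant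
jets). By irreducibility, the reduced coordinate ring is a domain in which `∂_k f ≠ 0`, hence
algebraic over the coordinates `x_i^{(j)}`, `i ≠ k`. -/

noncomputable section

namespace JetJac

open MvPolynomial Finset

/-! ### Universal property of the Hasse-Schmidt algebra -/

section HasseSchmidtAPI

variable (K : Type*) {A : Type*} [CommRing K] [CommRing A] [Algebra K A] (n : ℕ)

lemma hsd_zero_left (x : A) : hsd K A n 0 x = algebraMap A (HSAlg K A n) x := rfl

lemma hsd_add {i : ℕ} (hi : i ≤ n) (x y : A) :
    hsd K A n i (x + y) = hsd K A n i x + hsd K A n i y := by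
  rcases Nat.eq_zero_or_pos i with rfl | h
  · simp only [hsd_zero_left, map_add]
  · rw [← sub_eq_zero, ← sub_sub]
    simp only [hsd, ← map_sub]
    exact Ideal.Quotient.eq_zero_iff_mem.2
      (Ideal.subset_span (Or.inl (Or.inl ⟨x, y, i, h, hi, rfl⟩)))

lemma hsd_mul {i : ℕ} (hi : i ≤ n) (x y : A) :
    hsd K A n i (x * y) = ∑ jk ∈ antidiagonal i, hsd K A n jk.1 x * hsd K A n jk.2 y := by
  rw [← sub_eq_zero]
  simp only [hsd, ← map_sub, ← map_mul, ← map_sum]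
  exact Ideal.Quotient.eq_zero_iff_mem.2 (Ideal.subset_span (Or.inr ⟨x, y, i, hi, rfl⟩))

lemma hsd_algebraMap {i : ℕ} (h : 1 ≤ i) (hi : i ≤ n) (c : K) :
    hsd K A n i (algebraMap K A c) = 0 :=
  Ideal.Quotient.eq_zero_iff_mem.2 (Ideal.subset_span (Or.inl (Or.inr ⟨c, i, h, hi, rfl⟩)))

/-- The universal property of the Hasse-Schmidt algebra: the algebra map attached to a truncated
Hasse-Schmidt derivation `e` over an algebra map `φ`. -/
def hsLift {B : Type*} [CommRing B] (φ : A →+* B) (e : ℕ → A → B) (e_zero : ∀ x, e 0 x = φ x)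
    (e_add : ∀ i, 1 ≤ i → i ≤ n → ∀ x y, e i (x + y) = e i x + e i y)
    (e_const : ∀ i, 1 ≤ i → i ≤ n → ∀ c : K, e i (algebraMap K A c) = 0)
    (e_mul : ∀ i, i ≤ n → ∀ x y, e i (x * y) = ∑ jk ∈ antidiagonal i, e jk.1 x * e jk.2 y) :
    HSAlg K A n →+* B :=
  Ideal.Quotient.lift _ (eval₂Hom φ fun y => e (y.2 + 1) y.1) (by
    have key : ∀ i, i ≤ n → ∀ x, eval₂Hom φ (fun y : A × Fin n => e (y.2 + 1) y.1)
        (symb A n x i) = e i x := by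
      rintro (_ | i) hi x
      · simp [symb, e_zero]
      · simp [symb, Nat.lt_of_succ_le hi]
    suffices h : hsIdeal K A n ≤ RingHom.ker (eval₂Hom φ fun y => e (y.2 + 1) y.1) from
      fun a ha => RingHom.mem_ker.1 (h ha)
    rw [hsIdeal, Ideal.span_le]
    rintro P ((⟨x, y, i, h, hi, rfl⟩ | ⟨c, i, h, hi, rfl⟩) | ⟨x, y, i, hi, rfl⟩)
    · rw [SetLike.mem_coe, RingHom.mem_ker, map_sub, map_sub, key i hi, key i hi, key i hi,
        e_add i h hi]
      ring
    · rw [SetLike.mem_coe, RingHom.mem_ker, key i hi, e_const i h hi]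
    · rw [SetLike.mem_coe, RingHom.mem_ker, map_sub, map_sum, key i hi, e_mul i hi, sub_eq_zero]
      refine Finset.sum_congr rfl fun jk hjk => ?_
      have := mem_antidiagonal.1 hjk
      rw [map_mul, key _ (by omega), key _ (by omega)])

lemma hsLift_hsd {B : Type*} [CommRing B] (φ : A →+* B) (e : ℕ → A → B) (h₁ h₂ h₃ h₄)
    {i : ℕ} (hi : i ≤ n) (x : A) :
    hsLift K n φ e h₁ h₂ h₃ h₄ (hsd K A n i x) = e i x := by
  rw [hsd, hsLift, Ideal.Quotient.lift_mk]
  obtain _ | i := i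
  · simp [symb, h₁]
  · simp [symb, Nat.lt_of_succ_le hi]

/-- The constant jets: the ring homomorphism `HS^n_{A/K} → A` that kills all `d_i`, `i ≥ 1`. -/
def constJet : HSAlg K A n →+* A :=
  hsLift K n (RingHom.id A) (fun i x => if i = 0 then x else 0) (by simp)
    (by intro i h _ x y; simp [Nat.one_le_iff_ne_zero.1 h])
    (by intro i h _ c; simp [Nat.one_le_iff_ne_zero.1 h])
    (by
      intro i _ x y
      rcases Nat.eq_zero_or_pos i with rfl | h
      · simp
      · rw [if_neg h.ne', eq_comm]
        refine Finset.sum_eq_zero fun jk hjk => ?_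
        have := mem_antidiagonal.1 hjk
        rcases Nat.eq_zero_or_pos jk.1 with h1 | h1
        · simp [show jk.2 ≠ 0 by omega]
        · simp [h1.ne'])

lemma constJet_hsd_zero (x : A) : constJet K n (hsd K A n 0 x) = x := by
  rw [constJet, hsLift_hsd K n _ _ _ _ _ _ (Nat.zero_le n)]
  simp

end HasseSchmidtAPI

/-! ### Coefficients of a polynomial along the generic jet -/

section GenericJet

variable {K : Type*} [CommRing K] {s : ℕ} (n : ℕ)

/-- The substitution of the generic `n`-jet `x_i = ∑ j, x_i^{(j)} t^j` into a polynomial. -/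
def genericJet : MvPolynomial (Fin s) K →ₐ[K]
    PowerSeries (MvPolynomial (Fin s × Fin (n + 1)) K) :=
  aeval fun i => PowerSeries.mk fun j => if h : j < n + 1 then X (i, ⟨j, h⟩) else 0

/-- The coefficient of `t^j` in `g(∑ j, x^{(j)} t^j)`. -/
def jetCoeff (j : ℕ) (g : MvPolynomial (Fin s) K) : MvPolynomial (Fin s × Fin (n + 1)) K :=
  PowerSeries.coeff j (genericJet n g)

lemma jetCoeff_add (j : ℕ) (g h : MvPolynomial (Fin s) K) :
    jetCoeff n j (g + h) = jetCoeff n j g + jetCoeff n j h := by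
  simp [jetCoeff]

lemma jetCoeff_mul (j : ℕ) (g h : MvPolynomial (Fin s) K) :
    jetCoeff n j (g * h) = ∑ ab ∈ antidiagonal j, jetCoeff n ab.1 g * jetCoeff n ab.2 h := by
  simp [jetCoeff, PowerSeries.coeff_mul]

lemma jetCoeff_X (i : Fin s) (j : Fin (n + 1)) :
    jetCoeff (K := K) n j (X i) = X (i, j) := by
  simp [jetCoeff, genericJet, Nat.not_lt.2 (Nat.lt_succ_iff.1 j.2)]

lemma jetCoeff_C (j : ℕ) (c : K) :
    jetCoeff (s := s) n j (C c) = if j = 0 then C c else 0 := by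
  simp only [jetCoeff, ← algebraMap_eq, AlgHom.commutes]
  rw [PowerSeries.algebraMap_apply, PowerSeries.coeff_C]

lemma jetCoeff_zero_left (g : MvPolynomial (Fin s) K) :
    jetCoeff n 0 g = rename (fun i => (i, 0)) g := by
  induction g using MvPolynomial.induction_on with
  | C c => simp [jetCoeff_C]
  | add g h hg hh => simp [jetCoeff_add, hg, hh]
  | mul_X g i hg =>
    have := jetCoeff_X (K := K) n i 0
    simp only [Fin.val_zero] at this
    simp [jetCoeff_mul, hg, this]

lemma jetCoeff_mem_adjoin {j : ℕ} (hj : j ≤ n) (g : MvPolynomial (Fin s) K) :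
    jetCoeff n j g ∈ Algebra.adjoin K
      ((X : Fin s × Fin (n + 1) → MvPolynomial _ K) '' {il | (il.2 : ℕ) ≤ j}) := by
  induction g using MvPolynomial.induction_on generalizing j with
  | C c =>
    rw [jetCoeff_C]
    split_ifs
    · exact Subalgebra.algebraMap_mem _ c
    · exact Subalgebra.zero_mem _
  | add g h hg hh => rw [jetCoeff_add]; exact add_mem (hg hj) (hh hj)
  | mul_X g i hg =>
    rw [jetCoeff_mul]
    refine sum_mem fun ab hab => ?_
    have := mem_antidiagonal.1 hab
    refine mul_mem (Algebra.adjoin_mono (Set.image_mono fun il hil => ?_) (hg (j := ab.1) (by omega)))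
      ?_
    · simp only [Set.mem_ofPred_eq] at hil ⊢; omega
    · refine Algebra.subset_adjoin ⟨(i, ⟨ab.2, by omega⟩), by simp; omega, ?_⟩
      rw [← jetCoeff_X]

/-- The variables that come before `x_k^{(j)}` in the elimination of `x_k^{(j)}` from the `j`-th
equation of the jet scheme. -/
def precedingVars (K : Type*) [CommRing K] {s : ℕ} (n : ℕ) (k : Fin s) (j : ℕ) :
    Set (MvPolynomial (Fin s × Fin (n + 1)) K) :=
  X '' {il | (il.2 : ℕ) < j ∨ ((il.2 : ℕ) = j ∧ il.1 ≠ k)}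

lemma jetCoeff_mem_adjoin_precedingVars (k : Fin s) {i j : ℕ} (hij : i < j) (hj : j ≤ n)
    (g : MvPolynomial (Fin s) K) :
    jetCoeff n i g ∈ Algebra.adjoin K (precedingVars K n k j) := by
  refine Algebra.adjoin_mono (Set.image_mono fun il hil => ?_) (jetCoeff_mem_adjoin n (hij.le.trans hj) g)
  simp only [Set.mem_ofPred_eq] at hil ⊢
  omega

/-- The `j`-th coefficient is affine in `x_k^{(j)}`, with slope `∂_k g (x^{(0)})`. -/
lemma jetCoeff_sub_mem (k : Fin s) (j : Fin (n + 1)) (hj : j ≠ 0) (g : MvPolynomial (Fin s) K) :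
    jetCoeff n j g - jetCoeff n 0 (pderiv k g) * X (k, j) ∈
      Algebra.adjoin K (precedingVars K n k j) := by
  have hj0 : 0 < (j : ℕ) := Nat.pos_of_ne_zero fun h => hj (Fin.ext h)
  have hjn : (j : ℕ) ≤ n := Nat.lt_succ_iff.1 j.2
  have low : ∀ i, i < (j : ℕ) → ∀ g : MvPolynomial (Fin s) K,
      jetCoeff n i g ∈ Algebra.adjoin K (precedingVars K n k j) :=
    fun i hi g => jetCoeff_mem_adjoin_precedingVars n k hi hjn g
  induction g using MvPolynomial.induction_on with
  | C c => simp [jetCoeff_C, hj0.ne', jetCoeff_zero_left]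
  | add g h hg hh =>
    rw [jetCoeff_add, map_add, jetCoeff_add]
    convert add_mem hg hh using 1
    ring
  | mul_X g i hg =>
    -- Only the terms `(0, j)` and `(j, 0)` of the convolution involve order `j`; they are distinct
    -- because `j > 0`.
    have hlead : jetCoeff n j (g * X i) = jetCoeff n 0 g * X (i, j)
        + jetCoeff n j g * jetCoeff n 0 (X i)
        + ∑ ab ∈ antidiagonal (j : ℕ) with ab.1 ≠ 0 ∧ ab.2 ≠ 0,
            jetCoeff n ab.1 g * jetCoeff n ab.2 (X i) := by
      rw [← jetCoeff_X n i j, jetCoeff_mul]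
      refine (Finset.sum_filter_add_sum_filter_not (antidiagonal (j : ℕ))
        (fun ab => ab.1 ≠ 0 ∧ ab.2 ≠ 0) _).symm.trans ((add_comm _ _).trans ?_)
      congr 1
      have : (antidiagonal (j : ℕ)).filter (fun ab => ¬ (ab.1 ≠ 0 ∧ ab.2 ≠ 0))
          = {((0 : ℕ), (j : ℕ)), ((j : ℕ), 0)} := by
        ext ⟨a, b⟩
        simp only [mem_filter, HasAntidiagonal.mem_antidiagonal, mem_insert, mem_singleton, Prod.mk.injEq]
        omega
      rw [this, Finset.sum_pair (by simp; omega)]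
    have hrest : ∑ ab ∈ antidiagonal (j : ℕ) with ab.1 ≠ 0 ∧ ab.2 ≠ 0,
        jetCoeff n ab.1 g * jetCoeff n ab.2 (X i) ∈
          Algebra.adjoin K (precedingVars K n k j) := by
      refine sum_mem fun ab hab => ?_
      simp only [mem_filter, HasAntidiagonal.mem_antidiagonal] at hab
      exact mul_mem (low _ (by omega) _) (low _ (by omega) _)
    have hmain : jetCoeff n j (g * X i) - jetCoeff n 0 (pderiv k (g * X i)) * X (k, j) =
        (jetCoeff n j g - jetCoeff n 0 (pderiv k g) * X (k, j)) * jetCoeff n 0 (X i)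
        + jetCoeff n 0 g * (X (i, j) - jetCoeff n 0 (pderiv k (X i)) * X (k, j))
        + ∑ ab ∈ antidiagonal (j : ℕ) with ab.1 ≠ 0 ∧ ab.2 ≠ 0,
            jetCoeff n ab.1 g * jetCoeff n ab.2 (X i) := by
      rw [hlead, Derivation.leibniz]
      simp only [smul_eq_mul, jetCoeff_add, jetCoeff_zero_left, map_mul]
      ring
    rw [hmain]
    refine add_mem (add_mem (mul_mem hg (low 0 hj0 _)) (mul_mem (low 0 hj0 _) ?_)) hrest
    by_cases hik : i = k
    · subst hik
      simp [jetCoeff_zero_left]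
    · rw [pderiv_X_of_ne (fun h => hik h)]
      simp only [jetCoeff_zero_left, map_zero, zero_mul, sub_zero]
      exact Algebra.subset_adjoin ⟨(i, j), by simp [hik], rfl⟩

end GenericJet

/-! ### Equations of the jet scheme -/

section Presentation

variable {K : Type*} [Field K] {s : ℕ} (f : MvPolynomial (Fin s) K) (n : ℕ)

/-- The presentation of the coordinate ring of the jet scheme by the coordinates `x_i^{(j)}`. -/
def jetPres : MvPolynomial (Fin s × Fin (n + 1)) K →ₐ[K] JetRing f n :=
  aeval fun ij => hsd K (CoordRing f) n ij.2 (Ideal.Quotient.mk _ (X ij.1))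

lemma jetPres_jetCoeff {j : ℕ} (hj : j ≤ n) (g : MvPolynomial (Fin s) K) :
    jetPres f n (jetCoeff n j g) = hsd K (CoordRing f) n j (Ideal.Quotient.mk _ g) := by
  induction g using MvPolynomial.induction_on generalizing j with
  | C c =>
    have hc : Ideal.Quotient.mk (Ideal.span {f}) (C c) = algebraMap K (CoordRing f) c := rfl
    rw [jetCoeff_C, hc]
    split_ifs with h
    · subst h
      rw [hsd_zero_left, ← algebraMap_eq, AlgHom.commutes]
      exact IsScalarTower.algebraMap_apply K (CoordRing f) (JetRing f n) c
    · rw [map_zero, hsd_algebraMap K n (Nat.one_le_iff_ne_zero.2 h) hj]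
  | add g h hg hh => rw [jetCoeff_add, map_add, map_add, hsd_add K n hj, hg hj, hh hj]
  | mul_X g i hg =>
    rw [jetCoeff_mul, map_mul, hsd_mul K n hj, map_sum]
    refine Finset.sum_congr rfl fun ab hab => ?_
    have := mem_antidiagonal.1 hab
    rw [map_mul, hg (by omega)]
    congr 1
    have := jetCoeff_X (K := K) n i ⟨ab.2, by omega⟩
    simp only at this
    rw [this, jetPres, aeval_X]

lemma jetPres_jetCoeff_self {j : ℕ} (hj : j ≤ n) : jetPres f n (jetCoeff n j f) = 0 := by
  have h : Ideal.Quotient.mk (Ideal.span {f}) f = algebraMap K (CoordRing f) 0 := by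
    rw [map_zero]
    exact Ideal.Quotient.eq_zero_iff_mem.2 (Ideal.mem_span_singleton_self f)
  rw [jetPres_jetCoeff f n hj, h]
  rcases Nat.eq_zero_or_pos j with rfl | h'
  · rw [hsd_zero_left, map_zero, map_zero]
  · exact hsd_algebraMap K n h' hj 0

lemma jetPres_surjective : Function.Surjective (jetPres f n) := by
  intro y
  obtain ⟨P, rfl⟩ := Ideal.Quotient.mk_surjective y
  induction P using MvPolynomial.induction_on with
  | C a =>
    obtain ⟨g, rfl⟩ := Ideal.Quotient.mk_surjective a
    exact ⟨jetCoeff n 0 g, jetPres_jetCoeff f n (Nat.zero_le n) g⟩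
  | add P Q hP hQ =>
    obtain ⟨u, hu⟩ := hP
    obtain ⟨v, hv⟩ := hQ
    exact ⟨u + v, by rw [map_add, hu, hv, map_add]⟩
  | mul_X P x hP =>
    obtain ⟨u, hu⟩ := hP
    obtain ⟨a, j⟩ := x
    obtain ⟨g, rfl⟩ := Ideal.Quotient.mk_surjective a
    refine ⟨u * jetCoeff n (j + 1) g, ?_⟩
    rw [map_mul, hu, map_mul, jetPres_jetCoeff f n (by omega)]
    simp [hsd, symb]

/-- The ideal of the jet scheme in the affine space with the coordinates `x_i^{(j)}`. -/
def jetIdeal : Ideal (MvPolynomial (Fin s × Fin (n + 1)) K) :=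
  Ideal.span (Set.range fun j : Fin (n + 1) => jetCoeff n j f)

lemma jetCoeff_mul_self_mem {j : ℕ} (hj : j ≤ n) (g : MvPolynomial (Fin s) K) :
    jetCoeff n j (f * g) ∈ jetIdeal f n := by
  rw [jetCoeff_mul]
  refine sum_mem fun ab hab => ?_
  have := mem_antidiagonal.1 hab
  exact Ideal.mul_mem_right _ _ (Ideal.subset_span ⟨⟨ab.1, by omega⟩, rfl⟩)

/-- The components of the truncated Hasse-Schmidt derivation of `A` given by the generic jet. -/
def genericJetCoeff (j : ℕ) (x : CoordRing f) :
    MvPolynomial (Fin s × Fin (n + 1)) K ⧸ jetIdeal f n :=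
  Ideal.Quotient.mk _ (jetCoeff n j (Quotient.out x))

/-- Two representatives differ by a multiple of `f`, whose coefficients of order at most `n` lie in
`jetIdeal f n`; so the choice made by `Quotient.out` is harmless. -/
lemma genericJetCoeff_mk {j : ℕ} (hj : j ≤ n) (g : MvPolynomial (Fin s) K) :
    genericJetCoeff f n j (Ideal.Quotient.mk _ g) = Ideal.Quotient.mk _ (jetCoeff n j g) := by
  have h : Ideal.Quotient.mk (Ideal.span {f})
      (Quotient.out (Ideal.Quotient.mk (Ideal.span {f}) g)) = Ideal.Quotient.mk _ g :=
    Quotient.out_eq _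
  obtain ⟨u, hu⟩ := Ideal.mem_span_singleton.1 (Ideal.Quotient.eq.1 h)
  rw [genericJetCoeff, sub_eq_iff_eq_add.1 hu, jetCoeff_add, map_add,
    Ideal.Quotient.eq_zero_iff_mem.2 (jetCoeff_mul_self_mem f n hj u), zero_add]

/-- The inverse of the presentation. -/
def jetPresInv : JetRing f n →+* MvPolynomial (Fin s × Fin (n + 1)) K ⧸ jetIdeal f n :=
  hsLift K n
    (Ideal.Quotient.lift (Ideal.span {f})
      ((Ideal.Quotient.mk (jetIdeal f n)).comp (rename fun i => (i, 0)).toRingHom) (by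
        intro a ha
        obtain ⟨u, rfl⟩ := Ideal.mem_span_singleton.1 ha
        have := jetCoeff_mul_self_mem f n (Nat.zero_le n) u
        rw [jetCoeff_zero_left] at this
        exact Ideal.Quotient.eq_zero_iff_mem.2 this))
    (genericJetCoeff f n)
    (by
      intro x
      obtain ⟨g, rfl⟩ := Ideal.Quotient.mk_surjective x
      rw [genericJetCoeff_mk f n (Nat.zero_le n), jetCoeff_zero_left]
      rfl)
    (by
      intro i _ hi x y
      obtain ⟨g, rfl⟩ := Ideal.Quotient.mk_surjective x
      obtain ⟨h, rfl⟩ := Ideal.Quotient.mk_surjective y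
      rw [← map_add, genericJetCoeff_mk f n hi, genericJetCoeff_mk f n hi,
        genericJetCoeff_mk f n hi, jetCoeff_add, map_add])
    (by
      intro i h hi c
      have hc : algebraMap K (CoordRing f) c = Ideal.Quotient.mk (Ideal.span {f}) (C c) := rfl
      rw [hc, genericJetCoeff_mk f n hi, jetCoeff_C, if_neg (Nat.one_le_iff_ne_zero.1 h), map_zero])
    (by
      intro i hi x y
      obtain ⟨g, rfl⟩ := Ideal.Quotient.mk_surjective x
      obtain ⟨h, rfl⟩ := Ideal.Quotient.mk_surjective y
      rw [← map_mul, genericJetCoeff_mk f n hi, jetCoeff_mul, map_sum]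
      refine Finset.sum_congr rfl fun ab hab => ?_
      have := mem_antidiagonal.1 hab
      rw [genericJetCoeff_mk f n (by omega), genericJetCoeff_mk f n (by omega), map_mul])

/-- This composite alone suffices to bound the kernel of `jetPres` from above. -/
lemma jetPresInv_jetPres (P : MvPolynomial (Fin s × Fin (n + 1)) K) :
    jetPresInv f n (jetPres f n P) = Ideal.Quotient.mk _ P := by
  induction P using MvPolynomial.induction_on with
  | C c =>
    have h := jetPres_jetCoeff f n (Nat.zero_le n) (C c)
    have h' := jetCoeff_C (s := s) n 0 c
    rw [if_pos rfl] at h'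
    rw [h'] at h
    rw [h, jetPresInv, hsLift_hsd K n _ _ _ _ _ _ (Nat.zero_le n),
      genericJetCoeff_mk f n (Nat.zero_le n), h']
  | add P Q hP hQ => rw [map_add, map_add, map_add, hP, hQ]
  | mul_X P ij hP =>
    rw [map_mul, map_mul, map_mul, hP]
    congr 1
    have hj : (ij.2 : ℕ) ≤ n := Nat.lt_succ_iff.1 ij.2.2
    rw [jetPres, aeval_X, jetPresInv, hsLift_hsd K n _ _ _ _ _ _ hj,
      genericJetCoeff_mk f n hj, jetCoeff_X]

/-- `J_n(V(f))` is cut out by the `n + 1` coefficients of `f(∑ j, x^{(j)} t^j)`. -/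
lemma ker_jetPres : RingHom.ker (jetPres f n) = jetIdeal f n := by
  apply le_antisymm
  · intro P hP
    have := jetPresInv_jetPres f n P
    rw [RingHom.mem_ker.1 hP, map_zero] at this
    exact Ideal.Quotient.eq_zero_iff_mem.1 this.symm
  · rw [jetIdeal, Ideal.span_le]
    rintro _ ⟨j, rfl⟩
    exact jetPres_jetCoeff_self f n (Nat.lt_succ_iff.1 j.2)

end Presentation

/-! ### Counting multi-indices -/

section MultiIndices

variable {s m : ℕ}

lemma mem_rowIdx {β : Fin s →₀ ℕ} : β ∈ rowIdx s m ↔ β.degree < m := by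
  simp [rowIdx, mem_finsuppAntidiag, Finsupp.degree_eq_sum]

lemma mem_colIdx {α : Fin s →₀ ℕ} : α ∈ colIdx s m ↔ 1 ≤ α.degree ∧ α.degree ≤ m := by
  simp [colIdx, mem_finsuppAntidiag, Finsupp.degree_eq_sum]

lemma exists_eq_single_of_degree_eq_one {δ : Fin s →₀ ℕ} (h : δ.degree = 1) :
    ∃ k, δ = Finsupp.single k 1 := by
  obtain ⟨k, hk⟩ : ∃ k, δ k ≠ 0 := by
    by_contra! h0
    rw [show δ = 0 from Finsupp.ext h0, map_zero] at h
    exact zero_ne_one h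
  have hle : Finsupp.single k 1 ≤ δ :=
    Finsupp.single_le_iff.2 (Nat.one_le_iff_ne_zero.2 hk)
  have hsum := add_tsub_cancel_of_le hle
  have hdeg := congrArg Finsupp.degree hsum
  rw [map_add, Finsupp.degree_single, h] at hdeg
  rw [(Finsupp.degree_eq_zero_iff (δ - Finsupp.single k 1)).1 (by omega), add_zero] at hsum
  exact ⟨k, hsum.symm⟩

/-- Summing over degrees gives the hockey-stick identity. For `s = m = 0` the truncated formula
would give 1 instead of 0. -/
lemma card_rowIdx (hs : 0 < s) : (rowIdx s m).card = (m + s - 1).choose s := by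
  obtain ⟨t, rfl⟩ : ∃ t, s = t + 1 := ⟨s - 1, by omega⟩
  rw [rowIdx, card_biUnion]
  · simp only [card_finsuppAntidiag_nat_eq_choose, card_univ, Fintype.card_fin]
    induction m with
    | zero => simp
    | succ m ih =>
      rw [sum_range_succ, ih, show m + 1 + (t + 1) - 1 = (t + m) + 1 by omega,
        show m + (t + 1) - 1 = t + m by omega, show t + 1 + m - 1 = t + m by omega,
        Nat.choose_succ_succ, ← Nat.choose_symm_add (a := t) (b := m), add_comm]
  · intro i _ j _ hij
    rw [Function.onFun, disjoint_left]
    intro β h1 h2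
    exact hij (((mem_finsuppAntidiag.1 h1).1).symm.trans (mem_finsuppAntidiag.1 h2).1)

end MultiIndices

section DividedDerivatives

variable {K : Type*} [CommRing K] {s : ℕ}

lemma dividedDeriv_zero (f : MvPolynomial (Fin s) K) : dividedDeriv 0 f = f := by
  conv_rhs => rw [f.as_sum]
  simp [dividedDeriv]

lemma dividedDeriv_single (k : Fin s) (f : MvPolynomial (Fin s) K) :
    dividedDeriv (Finsupp.single k 1) f = pderiv k f := by
  conv_rhs => rw [f.as_sum, map_sum]
  refine Finset.sum_congr rfl fun γ _ => ?_
  rw [pderiv_monomial, Finset.prod_eq_single k]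
  · simp [mul_comm]
  · intro i _ hik
    simp [hik.symm]
  · simp

end DividedDerivatives

/-! ### Rank of the matrix and the gradient at the base point -/

section Rank

variable {K : Type*} [Field K] {s : ℕ} (f : MvPolynomial (Fin s) K) (n m : ℕ)

lemma rank_eq_card_iff_linearIndependent_row {ι κ : Type*} [Fintype ι] [Fintype κ]
    (M : Matrix ι κ K) : M.rank = Fintype.card ι ↔ LinearIndependent K M.row := by
  rw [linearIndependent_iff_card_eq_finrank_span, Matrix.rank_eq_finrank_span_row, eq_comm]
  rfl

variable {f n m} (p : JetRing f n →ₐ[K] K)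

lemma jetHigherJac_map_apply (a b : Fin (n + 1)) (β : rowIdx s m) (α : colIdx s m) :
    ((jetHigherJac f n m).map p) (a, β) (b, α) =
      if a ≤ b then p (hsd K (CoordRing f) n ((b : ℕ) - a)
        (Ideal.Quotient.mk _ (higherJac m f β α))) else 0 := by
  simp only [jetHigherJac, jetMatrix, Matrix.map_apply]
  split_ifs <;> simp

/-- The value at a point of the jet scheme of a function on the base. -/
def baseEval : MvPolynomial (Fin s) K →+* K :=
  (p : JetRing f n →+* K).comp ((algebraMap (CoordRing f) (JetRing f n)).comp
    (Ideal.Quotient.mk (Ideal.span {f})))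

lemma baseEval_apply (g : MvPolynomial (Fin s) K) :
    baseEval p g = p (hsd K (CoordRing f) n 0 (Ideal.Quotient.mk _ g)) := rfl

lemma baseEval_self : baseEval p f = 0 := by
  rw [baseEval, RingHom.comp_apply, RingHom.comp_apply,
    Ideal.Quotient.eq_zero_iff_mem.2 (Ideal.mem_span_singleton_self f), map_zero, map_zero]

lemma exists_pderiv_ne_zero_of_linearIndependent_row (hs : 0 < s) (hm : 1 ≤ m)
    (h : LinearIndependent K ((jetHigherJac f n m).map p).row) :
    ∃ k, baseEval p (pderiv k f) ≠ 0 := by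
  by_contra! hf
  -- In the last block row only the diagonal block survives, and from `|β| = m - 1` a column `|α| ≤
  -- m` is reached by a derivative of order at most 1.
  have hβ : Finsupp.single (⟨0, hs⟩ : Fin s) (m - 1) ∈ rowIdx s m := by
    rw [mem_rowIdx, Finsupp.degree_single]; omega
  refine h.ne_zero (Fin.last n, ⟨_, hβ⟩) (funext fun bα => ?_)
  obtain ⟨b, α⟩ := bα
  rw [Matrix.row_apply, jetHigherJac_map_apply]
  change _ = (0 : K)
  split_ifs with hb
  · obtain rfl : b = Fin.last n := le_antisymm (Fin.le_last b) hb
    rw [Nat.sub_self, ← baseEval_apply, higherJac]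
    split_ifs with hle
    · have hdeg := congrArg Finsupp.degree (add_tsub_cancel_of_le hle)
      rw [map_add, Finsupp.degree_single] at hdeg
      dsimp only at hdeg
      have := (mem_colIdx.1 α.2).2
      rcases Nat.eq_zero_or_pos ((α : Fin s →₀ ℕ) -
        Finsupp.single (⟨0, hs⟩ : Fin s) (m - 1)).degree with h0 | h0
      · rw [(Finsupp.degree_eq_zero_iff _).1 h0, dividedDeriv_zero, baseEval_self]
      · obtain ⟨k, hk⟩ := exists_eq_single_of_degree_eq_one (show ((α : Fin s →₀ ℕ) -
          Finsupp.single (⟨0, hs⟩ : Fin s) (m - 1)).degree = 1 by omega)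
        rw [hk, dividedDeriv_single, hf]
    · exact map_zero _
  · rfl

lemma linearIndependent_row_of_pderiv_ne_zero {k : Fin s} (hk : baseEval p (pderiv k f) ≠ 0) :
    LinearIndependent K ((jetHigherJac f n m).map p).row := by
  rw [Fintype.linearIndependent_iff]
  intro c hc
  have hcol : ∀ bα, ∑ aβ, c aβ * ((jetHigherJac f n m).map p) aβ bα = 0 := by
    intro bα
    simpa [Finset.sum_apply] using congrFun hc bα
  -- Nested strong induction on the block `a`, the degree `d = |β|` and `e = |β| - β_k`, which makes
  -- the chosen minor triangular.
  have main : ∀ (a d e : ℕ) (ha : a < n + 1) (β : rowIdx s m), (β : Fin s →₀ ℕ).degree = d →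
      d - (β : Fin s →₀ ℕ) k = e → c (⟨a, ha⟩, β) = 0 := by
    intro a
    induction a using Nat.strong_induction_on with
    | _ a iha =>
    intro d
    induction d using Nat.strong_induction_on with
    | _ d ihd =>
    intro e
    induction e using Nat.strong_induction_on with
    | _ e ihe =>
    intro ha β hβd hβe
    have hβm := mem_rowIdx.1 β.2
    have hα : (β : Fin s →₀ ℕ) + Finsupp.single k 1 ∈ colIdx s m := by
      rw [mem_colIdx, map_add, Finsupp.degree_single]
      omega
    have := hcol (⟨a, ha⟩, ⟨_, hα⟩)
    rw [Finset.sum_eq_single (⟨a, ha⟩, β)] at this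
    · rw [jetHigherJac_map_apply, if_pos le_rfl, Nat.sub_self, ← baseEval_apply, higherJac,
        if_pos le_self_add, add_tsub_cancel_left, dividedDeriv_single] at this
      exact (mul_eq_zero.1 this).resolve_right hk
    · rintro ⟨⟨a', ha'⟩, β'⟩ - hne
      rw [jetHigherJac_map_apply]
      split_ifs with hle
      · rcases (show a' ≤ a from hle).lt_or_eq with hlt | rfl
        · rw [iha a' hlt _ _ ha' β' rfl rfl, zero_mul]
        rw [Nat.sub_self, ← baseEval_apply, higherJac]
        split_ifs with hle'
        · have hsum := add_tsub_cancel_of_le hle'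
          have hdeg := congrArg Finsupp.degree hsum
          rw [map_add, map_add, Finsupp.degree_single, hβd] at hdeg
          dsimp only at hdeg hsum ⊢
          generalize (β : Fin s →₀ ℕ) + Finsupp.single k 1 - (β' : Fin s →₀ ℕ) = δ at hdeg hsum ⊢
          -- Order 0 gives `f = 0`. Order 1 in a direction `i ≠ k` gives `β' = β + e_k - e_i`, of
          -- the same degree but smaller `e`. Higher order gives a smaller degree.
          rcases lt_trichotomy δ.degree 1 with h1 | h1 | h1
          · rw [(Finsupp.degree_eq_zero_iff δ).1 (by omega), dividedDeriv_zero, baseEval_self,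
              mul_zero]
          · obtain ⟨i, rfl⟩ := exists_eq_single_of_degree_eq_one h1
            have hik : i ≠ k := by
              rintro rfl
              exact hne (by rw [Subtype.ext (add_right_cancel hsum)])
            have hkk := DFunLike.congr_fun hsum k
            simp [hik] at hkk
            have hb : (β' : Fin s →₀ ℕ) k ≤ (β' : Fin s →₀ ℕ).degree := Finsupp.le_degree _ _
            rw [ihe (d - (β' : Fin s →₀ ℕ) k) (by omega) ha' β' (by omega) rfl, zero_mul]
          · rw [ihd (β' : Fin s →₀ ℕ).degree (by omega) _ ha' β' rfl rfl, zero_mul]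
        · rw [map_zero, mul_zero]
      · rw [mul_zero]
    · simp
  rintro ⟨⟨a, ha⟩, β⟩
  exact main a _ _ ha β rfl rfl

/-- The matrix `D_n(Jac_m(f))` has full rank at a point if and only if the gradient of `f` does not
vanish at its base point. -/
theorem rank_jetHigherJac_eq_iff (hs : 0 < s) (hm : 1 ≤ m) :
    ((jetHigherJac f n m).map p).rank = (n + 1) * (m + s - 1).choose s ↔
      ∃ k, baseEval p (pderiv k f) ≠ 0 := by
  have hcard : Fintype.card (Fin (n + 1) × rowIdx s m) = (n + 1) * (m + s - 1).choose s := by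
    rw [Fintype.card_prod, Fintype.card_fin, Fintype.card_coe, card_rowIdx hs]
  rw [← hcard, rank_eq_card_iff_linearIndependent_row]
  exact ⟨exists_pderiv_ne_zero_of_linearIndependent_row p hs hm,
    fun ⟨_, hk⟩ => linearIndependent_row_of_pderiv_ne_zero p hk⟩

end Rank

/-! ### Heights of rational points -/

section HeightOfPoints

variable {K : Type*} [Field K] {σ : Type*}

/-- Translation of the affine space. -/
def translate (a : σ → K) : MvPolynomial σ K ≃ₐ[K] MvPolynomial σ K :=
  AlgEquiv.ofAlgHom (aeval fun i => X i + C (a i)) (aeval fun i => X i - C (a i))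
    (by ext i; simp [algebraMap_eq]) (by ext i; simp [algebraMap_eq])

lemma aeval_translate (a b : σ → K) (g : MvPolynomial σ K) :
    aeval b (translate a g) = aeval (b + a) g := by
  have : (aeval b).comp (translate a : MvPolynomial σ K →ₐ[K] MvPolynomial σ K) =
      aeval (b + a) := by
    ext i; simp [translate]
  exact DFunLike.congr_fun this g

lemma ker_aeval_isMaximal (a : σ → K) :
    (RingHom.ker (aeval (R := K) a)).IsMaximal :=
  RingHom.ker_isMaximal_of_surjective _ fun c => ⟨C c, by simp⟩

lemma height_ker_aeval_eq (a b : σ → K) :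
    (RingHom.ker (aeval (R := K) a)).height = (RingHom.ker (aeval (R := K) b)).height := by
  have h := (translate (b - a)).toRingEquiv.height_comap (RingHom.ker (aeval (R := K) a))
  have h' : (RingHom.ker (aeval (R := K) a)).comap (translate (b - a)).toRingEquiv =
      RingHom.ker (aeval (R := K) b) := by
    ext g
    have := aeval_translate (b - a) a g
    rw [add_sub_cancel] at this
    rw [RingHom.mem_ker, ← this]
    exact Iff.rfl
  rw [← h, h']

/-- By the Nullstellensatz every maximal ideal is a point, and translations give all points the same
height; so each attains the supremum, the dimension of affine space. -/
lemma height_ker_aeval [IsAlgClosed K] [Finite σ] (a : σ → K) :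
    (RingHom.ker (aeval (R := K) a)).height = Nat.card σ := by
  have h := Ideal.sup_isMaximal_height_eq_ringKrullDim (R := MvPolynomial σ K)
  rw [ringKrullDim_of_isNoetherianRing, ringKrullDim_eq_zero_of_field, zero_add] at h
  have h' : (⨆ (I : Ideal (MvPolynomial σ K)) (_ : I.IsMaximal), I.height) =
      (RingHom.ker (aeval (R := K) a)).height := by
    refine le_antisymm (iSup₂_le fun I hI => ?_)
      (le_iSup₂_of_le _ (ker_aeval_isMaximal a) le_rfl)
    obtain ⟨b, rfl⟩ := MvPolynomial.isMaximal_iff_eq_vanishingIdeal_singleton.1 hI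
    refine (le_of_eq ?_).trans (height_ker_aeval_eq b a).le
    congr 1
    ext g
    simp
  rw [h'] at h
  exact_mod_cast h

end HeightOfPoints

section PresentedRings

variable {K : Type*} [Field K] {σ : Type*} {R : Type*} [CommRing R] [Algebra K R]
  {ψ : MvPolynomial σ K →ₐ[K] R} (p : R →ₐ[K] K)

/-- The coordinates of a `K`-point with respect to a presentation of the coordinate ring. -/
def coords (ψ : MvPolynomial σ K →ₐ[K] R) (p : R →ₐ[K] K) (i : σ) : K := p (ψ (X i))

lemma aeval_coords (P : MvPolynomial σ K) : aeval (coords ψ p) P = p (ψ P) := by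
  have : aeval (coords ψ p) = p.comp ψ := by
    ext i; simp [coords]
  rw [this]; rfl

/-- By Krull's height theorem, a `K`-point of a closed subscheme of an affine space has at least
the height expected from the number of equations. -/
lemma card_le_height_ker_add_card [IsAlgClosed K] [Finite σ] (hψ : Function.Surjective ψ)
    {ι : Type*} [Fintype ι] {F : ι → MvPolynomial σ K}
    (hF : RingHom.ker ψ = Ideal.span (Set.range F)) :
    (Nat.card σ : ℕ∞) ≤ (RingHom.ker p).height + Fintype.card ι := by
  have hmax := ker_aeval_isMaximal (coords ψ p)
  have hsub : Set.range F ⊆ RingHom.ker (aeval (R := K) (coords ψ p)) := by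
    intro P hP
    have : P ∈ RingHom.ker ψ := hF ▸ Ideal.subset_span hP
    rw [SetLike.mem_coe, RingHom.mem_ker, aeval_coords, RingHom.mem_ker.1 this, map_zero]
  have h := Ideal.height_le_height_add_encard_of_subset _ hsub
  rw [height_ker_aeval] at h
  refine h.trans (add_le_add ?_ ?_)
  · let e : (MvPolynomial σ K ⧸ Ideal.span (Set.range F)) ≃+* R :=
      (Ideal.quotEquivOfEq hF.symm).trans
        (RingHom.quotientKerEquivOfSurjective (f := (ψ : MvPolynomial σ K →+* R)) hψ)
    have he : (RingHom.ker p).comap e =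
        (RingHom.ker (aeval (R := K) (coords ψ p))).map (Ideal.Quotient.mk _) := by
      have hmk : ∀ P, e (Ideal.Quotient.mk _ P) = ψ P := fun P => rfl
      apply le_antisymm
      · intro y hy
        obtain ⟨P, rfl⟩ := Ideal.Quotient.mk_surjective y
        refine Ideal.mem_map_of_mem _ ?_
        rw [Ideal.mem_comap, hmk, RingHom.mem_ker] at hy
        rw [RingHom.mem_ker, aeval_coords, hy]
      · rw [Ideal.map_le_iff_le_comap]
        intro P hP
        rw [Ideal.mem_comap, Ideal.mem_comap, hmk, RingHom.mem_ker, ← aeval_coords]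
        exact hP
    exact ((congrArg Ideal.height he).symm.trans (e.height_comap (RingHom.ker p))).le
  · rw [← Set.image_univ]
    refine (Set.encard_image_le _ _).trans ?_
    simp

lemma aeval_sub_mem_span (a : σ → K) (P : MvPolynomial σ K) :
    P - C (aeval a P) ∈ Ideal.span (Set.range fun i => X i - C (a i)) := by
  rw [← Ideal.Quotient.eq]
  have : Ideal.Quotient.mkₐ K (Ideal.span (Set.range fun i => X i - C (a i))) =
      ((Ideal.Quotient.mkₐ K _).comp (Algebra.ofId K (MvPolynomial σ K))).comp (aeval a) := by
    ext i
    have := Ideal.Quotient.eq.2 (Ideal.subset_span (Set.mem_range_self (f := fun i => X i - C (a i)) i))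
    simp only [AlgHom.comp_apply, aeval_X]
    exact this
  exact DFunLike.congr_fun this P

lemma ker_eq_span (hψ : Function.Surjective ψ) :
    RingHom.ker p = Ideal.span (Set.range fun i => ψ (X i) - algebraMap K R (coords ψ p i)) := by
  apply le_antisymm
  · intro y hy
    obtain ⟨P, rfl⟩ := hψ y
    have h := Ideal.mem_map_of_mem ψ (aeval_sub_mem_span (coords ψ p) P)
    rw [aeval_coords, RingHom.mem_ker.1 hy, map_zero, sub_zero, Ideal.map_span] at h
    refine Ideal.span_mono ?_ h
    rintro _ ⟨_, ⟨i, rfl⟩, rfl⟩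
    exact ⟨i, by simp [← algebraMap_eq]⟩
  · rw [Ideal.span_le]
    rintro _ ⟨i, rfl⟩
    simp [coords]

end PresentedRings

/-! ### Elimination of one coordinate direction; regularity -/

section Elimination

variable {K : Type*} [Field K] {s : ℕ}

/-- The restriction of a polynomial to the line through `x` in the `k`-th coordinate direction. -/
def restrictLine {B : Type*} [CommRing B] [Algebra K B] (x : Fin s → B) (k : Fin s) :
    MvPolynomial (Fin s) K →ₐ[K] Polynomial B :=
  aeval fun i => if i = k then Polynomial.X else Polynomial.C (x i)

variable {B : Type*} [CommRing B] [Algebra K B] (x : Fin s → B) (k : Fin s)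

lemma aeval_restrictLine {D : Type*} [CommRing D] [Algebra K D] [Algebra B D]
    [IsScalarTower K B D] (b : D) (g : MvPolynomial (Fin s) K) :
    Polynomial.aeval b (restrictLine x k g) =
      aeval (Function.update (fun i => algebraMap B D (x i)) k b) g := by
  have : ((Polynomial.aeval b).restrictScalars K).comp (restrictLine x k) =
      aeval (R := K) (Function.update (fun i => algebraMap B D (x i)) k b) := by
    ext i
    by_cases h : i = k
    · subst h; simp [restrictLine]
    · simp [restrictLine, h]
  rw [← this]
  simp

lemma eval_restrictLine (b : B) (g : MvPolynomial (Fin s) K) :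
    (restrictLine x k g).eval b = aeval (Function.update x k b) g := by
  rw [← Polynomial.coe_aeval_eq_eval, aeval_restrictLine]
  rfl

lemma derivative_restrictLine (g : MvPolynomial (Fin s) K) :
    (restrictLine x k g).derivative = restrictLine x k (pderiv k g) := by
  induction g using MvPolynomial.induction_on with
  | C c => simp [restrictLine, Polynomial.algebraMap_apply]
  | add g h hg hh => simp [hg, hh]
  | mul_X g i hg =>
    rw [map_mul, Polynomial.derivative_mul, hg, Derivation.leibniz, map_add, smul_eq_mul,
      smul_eq_mul, map_mul, map_mul, add_comm, mul_comm (restrictLine x k (X i))]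
    congr 2
    by_cases h : i = k
    · subst h; simp [restrictLine]
    · rw [pderiv_X_of_ne (fun h' => h h')]
      simp [restrictLine, h]

section Jets

variable {n : ℕ} {f : MvPolynomial (Fin s) K}

/-- At a point where `∂_k f ≠ 0`, the coordinates `x_k^{(j)}` can be eliminated from a system of
local parameters. -/
lemma sub_mem_span_of_pderiv_ne_zero {B : Type*} [CommRing B] [IsLocalRing B] [Algebra K B]
    (φ : MvPolynomial (Fin s × Fin (n + 1)) K →ₐ[K] B) (a : Fin s × Fin (n + 1) → K)
    (ha : ∀ ij, φ (X ij) - algebraMap K B (a ij) ∈ IsLocalRing.maximalIdeal B)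
    (hφ : ∀ j : Fin (n + 1), φ (jetCoeff n j f) = 0)
    (haf : ∀ j : Fin (n + 1), aeval a (jetCoeff n j f) = 0)
    {k : Fin s} (hk : aeval a (jetCoeff n 0 (pderiv k f)) ≠ 0) (ij : Fin s × Fin (n + 1)) :
    φ (X ij) - algebraMap K B (a ij) ∈
      Ideal.span ((fun ij => φ (X ij) - algebraMap K B (a ij)) '' {ij | ij.1 ≠ k}) := by
  set J := Ideal.span ((fun ij => φ (X ij) - algebraMap K B (a ij)) '' {ij | ij.1 ≠ k}) with hJ
  -- The claim becomes that the reduction `χ` of `φ` modulo `J` and the constant evaluation `ε` at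
  -- `a` agree on all variables.
  let χ : MvPolynomial (Fin s × Fin (n + 1)) K →ₐ[K] B ⧸ J := (Ideal.Quotient.mkₐ K J).comp φ
  let ε : MvPolynomial (Fin s × Fin (n + 1)) K →ₐ[K] B ⧸ J := (Algebra.ofId K (B ⧸ J)).comp (aeval a)
  have hε : ∀ P, ε P = algebraMap K (B ⧸ J) (aeval a P) := fun P => rfl
  have hχf : ∀ j : Fin (n + 1), χ (jetCoeff n j f) = 0 := fun j => by
    simp [χ, hφ j]
  have hεf : ∀ j : Fin (n + 1), ε (jetCoeff n j f) = 0 := fun j => by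
    rw [hε, haf j, map_zero]
  set c := aeval a (jetCoeff n 0 (pderiv k f)) with hc
  suffices main : ∀ (j : ℕ) (hj : j < n + 1) (i : Fin s), χ (X (i, ⟨j, hj⟩)) = ε (X (i, ⟨j, hj⟩)) by
    have := main ij.2 ij.2.2 ij.1
    rw [hε, aeval_X] at this
    exact Ideal.Quotient.eq.1 this
  have hne : ∀ j i, i ≠ k → χ (X (i, j)) = ε (X (i, j)) := fun j i hi => by
    rw [hε, aeval_X]
    exact Ideal.Quotient.eq.2 (Ideal.subset_span ⟨(i, j), hi, rfl⟩)
  intro j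
  induction j using Nat.strong_induction_on with
  | _ j ih =>
  intro hj i
  by_cases hi : i = k
  swap
  · exact hne _ _ hi
  subst hi
  rcases Nat.eq_zero_or_pos j with rfl | hpos
  · let x : Fin s → B ⧸ J := fun i' => ε (X (i', 0))
    let g := restrictLine (K := K) x i f
    have hcomp : ∀ (h : MvPolynomial (Fin s) K) (η : MvPolynomial (Fin s × Fin (n + 1)) K →ₐ[K] B ⧸ J),
        aeval (fun i' => η (X (i', 0))) h = η (jetCoeff n 0 h) := by
      intro h η
      rw [jetCoeff_zero_left, ← AlgHom.comp_apply]
      congr 1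
      ext i'
      simp
    have hg1 : g.eval (χ (X (i, 0))) = 0 := by
      rw [eval_restrictLine, ← hχf 0, Fin.val_zero, ← hcomp]
      congr 2
      funext i'
      by_cases h : i' = i
      · subst h; simp
      · rw [Function.update_of_ne h]; exact (hne 0 i' h).symm
    have hg2 : ∀ h : MvPolynomial (Fin s) K,
        (restrictLine (K := K) x i h).eval (ε (X (i, 0))) = ε (jetCoeff n 0 h) := by
      intro h
      rw [eval_restrictLine, ← hcomp, Function.update_eq_self_iff.2 rfl]
    -- Taylor expansion, as in Hensel uniqueness: with `y = χ x_k - ε x_k`, both values of `g`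
    -- vanish, so `(c + r y) y = 0`. The first factor lifts to a unit of the local ring `B`, since
    -- `c ≠ 0` and `y` lifts to the maximal ideal.
    obtain ⟨r, hr⟩ := g.binomExpansion (ε (X (i, 0))) (χ (X (i, 0)) - ε (X (i, 0)))
    rw [add_sub_cancel, hg1, hg2, derivative_restrictLine, hg2, hε (jetCoeff n 0 (pderiv i f)), ← hc]
      at hr
    have h0 : ε (jetCoeff n 0 f) = 0 := hεf 0
    rw [h0] at hr
    obtain ⟨r, rfl⟩ := Ideal.Quotient.mk_surjective r
    have hunit : IsUnit (algebraMap K B c + r * (φ (X (i, 0)) - algebraMap K B (a (i, 0)))) := by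
      by_contra hn
      have h1 := (IsLocalRing.mem_maximalIdeal _).2 hn
      have h2 := (Ideal.add_mem_iff_left _ (Ideal.mul_mem_left _ r (ha (i, 0)))).1 h1
      exact (IsLocalRing.mem_maximalIdeal _).1 h2 ((IsUnit.mk0 c hk).map (algebraMap K B))
    have hy : χ (X (i, 0)) - ε (X (i, 0)) =
        Ideal.Quotient.mk J (φ (X (i, 0)) - algebraMap K B (a (i, 0))) := by
      rw [hε, aeval_X, map_sub]; rfl
    have hprod : Ideal.Quotient.mk J (algebraMap K B c + r * (φ (X (i, 0)) - algebraMap K B (a (i, 0))))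
        * (χ (X (i, 0)) - ε (X (i, 0))) = 0 := by
      rw [map_add, map_mul, ← hy]
      have : Ideal.Quotient.mk J (algebraMap K B c) = algebraMap K (B ⧸ J) c := rfl
      rw [this]
      linear_combination -hr
    exact sub_eq_zero.1 (((hunit.map (Ideal.Quotient.mk J)).mul_right_eq_zero).1 hprod)
  · have hadj : ∀ h ∈ Algebra.adjoin K (precedingVars K n i j), χ h = ε h := by
      intro h hh
      have hle : Algebra.adjoin K (precedingVars K n i j) ≤ AlgHom.equalizer χ ε := by
        rw [Algebra.adjoin_le_iff]
        rintro _ ⟨⟨i', l⟩, hl | hl, rfl⟩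
        · exact ih l hl l.2 i'
        · exact hne l i' hl.2
      exact hle hh
    have hD := hadj _ (jetCoeff_mem_adjoin_precedingVars n i hpos (Nat.lt_succ_iff.1 hj) (pderiv i f))
    -- For `j ≥ 1` the equation is affine in `x_k^{(j)}`, so cancelling the unit slope suffices.
    have hG := hadj _ (jetCoeff_sub_mem n i ⟨j, hj⟩ (by simp [Fin.ext_iff, hpos.ne']) f)
    rw [map_sub, map_sub, hχf, hεf, map_mul, map_mul, hD, zero_sub, zero_sub, neg_inj, hε, ← hc] at hG
    exact ((IsUnit.mk0 c hk).map (algebraMap K (B ⧸ J))).mul_left_cancel hG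

variable {R : Type*} [CommRing R] [Algebra K R]
  {ψ : MvPolynomial (Fin s × Fin (n + 1)) K →ₐ[K] R} (p : R →ₐ[K] K)

/-- The points of the jet scheme over the smooth points of the hypersurface are non-singular. -/
theorem isNonsingularPoint_of_pderiv_ne_zero [IsAlgClosed K] (hψ : Function.Surjective ψ)
    (hker : RingHom.ker ψ = jetIdeal f n) {k : Fin s}
    (hk : p (ψ (jetCoeff n 0 (pderiv k f))) ≠ 0) : IsNonsingularPoint p := by
  have hp : (RingHom.ker p).IsPrime := RingHom.ker_isPrime p
  have : IsNoetherianRing R := isNoetherianRing_of_surjective _ _ ψ.toRingHom hψ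
  have : IsNoetherianRing (Localization.AtPrime (RingHom.ker p)) :=
    IsLocalization.isNoetherianRing (RingHom.ker p).primeCompl _ inferInstance
  let φ : MvPolynomial (Fin s × Fin (n + 1)) K →ₐ[K] Localization.AtPrime (RingHom.ker p) :=
    (IsScalarTower.toAlgHom K R _).comp ψ
  have hψf : ∀ j : Fin (n + 1), ψ (jetCoeff n j f) = 0 := fun j => by
    rw [← RingHom.mem_ker, hker]
    exact Ideal.subset_span ⟨j, rfl⟩
  have hmax : IsLocalRing.maximalIdeal (Localization.AtPrime (RingHom.ker p)) =
      Ideal.span (Set.range fun ij => φ (X ij) - algebraMap K _ (coords ψ p ij)) := by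
    rw [← Localization.AtPrime.map_eq_maximalIdeal]
    refine (congrArg (Ideal.map (algebraMap R _)) (ker_eq_span p hψ)).trans ?_
    rw [Ideal.map_span, ← Set.range_comp]
    congr 2
    funext ij
    simp [φ, ← IsScalarTower.algebraMap_apply]
  have hmax' : IsLocalRing.maximalIdeal (Localization.AtPrime (RingHom.ker p)) =
      Ideal.span ((fun ij => φ (X ij) - algebraMap K _ (coords ψ p ij)) '' {ij | ij.1 ≠ k}) := by
    apply le_antisymm
    · conv_lhs => rw [hmax]
      rw [Ideal.span_le]
      rintro _ ⟨ij, rfl⟩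
      refine sub_mem_span_of_pderiv_ne_zero (f := f) φ (coords ψ p) (fun ij => ?_) (fun j => ?_)
        (fun j => ?_) (k := k) ?_ ij
      · rw [hmax]; exact Ideal.subset_span ⟨ij, rfl⟩
      · simp [φ, hψf]
      · rw [aeval_coords, hψf, map_zero]
      · rwa [aeval_coords]
    · rw [hmax]
      exact Ideal.span_mono (Set.image_subset_range _ _)
  obtain ⟨t, rfl⟩ : ∃ t, s = t + 1 := ⟨s - 1, by have := k.2; omega⟩
  have hcard : ({ij : Fin (t + 1) × Fin (n + 1) | ij.1 ≠ k}).ncard = t * (n + 1) := by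
    have : {ij : Fin (t + 1) × Fin (n + 1) | ij.1 ≠ k} = {k}ᶜ ×ˢ Set.univ := by
      ext ij; simp
    rw [this, Set.ncard_prod, Set.ncard_compl]
    simp
  have hle : (IsLocalRing.maximalIdeal (Localization.AtPrime (RingHom.ker p))).spanFinrank ≤
      t * (n + 1) := by
    rw [hmax', ← hcard]
    exact (Submodule.spanFinrank_span_le_ncard_of_finite (Set.toFinite _)).trans
      (Set.ncard_image_le (Set.toFinite _))
  have hht := card_le_height_ker_add_card p hψ (F := fun j : Fin (n + 1) => jetCoeff n j f) hker
  refine IsRegularLocalRing.of_spanFinrank_maximalIdeal_le _ ?_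
  rw [IsLocalization.AtPrime.ringKrullDim_eq_height (RingHom.ker p)]
  have hht' : ((t * (n + 1) : ℕ) : ℕ∞) ≤ (RingHom.ker p).height := by
    refine (ENat.add_le_add_iff_right (ENat.natCast_ne_top (n + 1))).1 ?_
    refine le_trans (le_of_eq ?_) (hht.trans (le_of_eq ?_))
    · simp; ring
    · simp
  exact_mod_cast (Nat.cast_le.2 hle).trans hht'

end Jets

end Elimination

/-! ### Irreducible polynomials over perfect fields -/

section Separability

variable {K : Type*} [Field K] {σ : Type*}

lemma totalDegree_pderiv_lt {k : σ} {f : MvPolynomial σ K} (h : pderiv k f ≠ 0) :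
    (pderiv k f).totalDegree < f.totalDegree := by
  obtain ⟨μ, hμ, hdeg⟩ := Finset.exists_mem_eq_sup (pderiv k f).support (support_nonempty.2 h)
    fun μ => μ.sum fun _ e => e
  have hμ' : μ + Finsupp.single k 1 ∈ f.support := by
    rw [mem_support_iff, coeff_pderiv] at hμ
    exact mem_support_iff.2 (left_ne_zero_of_mul hμ)
  have := le_totalDegree hμ'
  rw [Finsupp.sum_add_index' (by simp) (by simp), Finsupp.sum_single_index rfl] at this
  rw [totalDegree, hdeg]
  exact this

lemma eq_expand_of_forall_dvd {p : ℕ} {f : MvPolynomial σ K}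
    (h : ∀ μ ∈ f.support, ∀ i, p ∣ μ i) : ∃ g, f = expand p g := by
  refine ⟨∑ μ ∈ f.support, monomial (μ.mapRange (· / p) (Nat.zero_div p)) (f.coeff μ), ?_⟩
  conv_lhs => rw [f.as_sum]
  rw [map_sum]
  refine Finset.sum_congr rfl fun μ hμ => ?_
  rw [expand_monomial]
  congr 2
  ext i
  simp [Nat.mul_div_cancel' (h μ hμ i)]

/-- Over a perfect field, an irreducible polynomial does not divide all of its derivatives. -/
lemma exists_not_dvd_pderiv [PerfectField K] {f : MvPolynomial σ K} (hf : Irreducible f) :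
    ∃ k, ¬ f ∣ pderiv k f := by
  by_contra! hdvd
  -- A nonzero derivative has smaller total degree, so it is not a multiple of `f`.
  have h0 : ∀ k, pderiv k f = 0 := fun k => by
    by_contra h
    exact (totalDegree_le_of_dvd_of_isDomain (hdvd k) h).not_gt (totalDegree_pderiv_lt h)
  obtain ⟨p, hp⟩ := CharP.exists K
  have hdiv : ∀ μ ∈ f.support, ∀ i, p ∣ μ i := fun μ hμ i => by
    by_cases hi : μ i = 0
    · simp [hi]
    rw [← CharP.cast_eq_zero_iff K]
    have hle : Finsupp.single i 1 ≤ μ := Finsupp.single_le_iff.2 (Nat.one_le_iff_ne_zero.2 hi)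
    have h := coeff_pderiv (i := i) f (μ - Finsupp.single i 1)
    rw [h0, coeff_zero, tsub_add_cancel_of_le hle] at h
    have := (mul_eq_zero.1 h.symm).resolve_left (mem_support_iff.1 hμ)
    rw [Finsupp.tsub_apply, Finsupp.single_eq_same] at this
    rw [← Nat.sub_add_cancel (Nat.one_le_iff_ne_zero.2 hi)]
    exact_mod_cast this
  rcases CharP.char_is_prime_or_zero K p with hprime | rfl
  · have := Fact.mk hprime
    have : ExpChar K p := ExpChar.prime hprime
    obtain ⟨g, rfl⟩ := eq_expand_of_forall_dvd hdiv
    -- Taking `p`-th roots of the coefficients makes `f` a `p`-th power, contradicting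
    -- irreducibility.
    have hpow : expand p g = (g.map (frobeniusEquiv K p).symm.toRingHom) ^ p := by
      rw [← map_frobenius_expand p, map_expand, MvPolynomial.map_map]
      have : (frobenius K p).comp (frobeniusEquiv K p).symm.toRingHom = RingHom.id K := by
        ext x; simp
      rw [this, MvPolynomial.map_id]
    rw [hpow] at hf
    exact not_irreducible_pow hprime.ne_one hf
  · classical
    have hC : f = C (f.coeff 0) := by
      ext μ
      rw [coeff_C]
      split_ifs with h
      · rw [h]
      · by_contra hμ
        exact h (Finsupp.ext fun i =>
          (zero_dvd_iff.1 (hdiv μ (mem_support_iff.2 hμ) i)).symm)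
    have hne : f.coeff 0 ≠ 0 := fun h => hf.ne_zero (by rw [hC, h, C_0])
    exact hf.not_isUnit (hC ▸ (IsUnit.mk0 _ hne).map C)

end Separability

/-! ### Upper bound for the dimension of the jet scheme -/

section Dimension

variable {K : Type*} [Field K]

/-- Incomparability: strict inclusions of primes stay strict after contraction to `A`. -/
lemma ringKrullDim_le_of_isIntegral {A B : Type*} [CommRing A] [CommRing B] [Algebra A B]
    [Algebra.IsIntegral A B] : ringKrullDim B ≤ ringKrullDim A :=
  Order.krullDim_le_of_strictMono (PrimeSpectrum.comap (algebraMap A B)) fun I J h => by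
    have : I.asIdeal.IsPrime := I.2
    exact Ideal.IsIntegral.comap_lt_comap (R := A) (I := I.asIdeal) (J := J.asIdeal) h

open Cardinal in
/-- The dimension of an affine domain is at most the number of elements over which it is
algebraic. -/
lemma ringKrullDim_le_card {A : Type*} [CommRing A] [IsDomain A] [Algebra K A]
    [Algebra.FiniteType K A] (t : Finset A)
    [Algebra.IsAlgebraic (Algebra.adjoin K (t : Set A)) A] : ringKrullDim A ≤ t.card := by
  -- Noether normalization: the dimension is at most `r`, and `r` is at most the transcendence
  -- degree.
  obtain ⟨r, g, hg, hint⟩ := exists_integral_inj_algHom_of_fg K A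
  algebraize [g.toRingHom]
  have : Algebra.IsIntegral (MvPolynomial (Fin r) K) A := ⟨hint⟩
  refine (ringKrullDim_le_of_isIntegral (A := MvPolynomial (Fin r) K)).trans ?_
  rw [ringKrullDim_of_isNoetherianRing, ringKrullDim_eq_zero_of_field, zero_add, Nat.card_fin]
  have h1 := MvPolynomial.aeval_unique g
  have h2 : AlgebraicIndependent K fun i => g (X i) := by
    rw [AlgebraicIndependent]; exact h1 ▸ hg
  have h3 := h2.lift_cardinalMk_le_trdeg
  have h4 := lift_le.{0}.2 (Algebra.IsAlgebraic.trdeg_le_cardinalMk K (t : Set A))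
  have h5 : r ≤ t.card := by simpa using h3.trans h4
  exact_mod_cast h5

lemma ringKrullDim_quotient_nilradical (A : Type*) [CommRing A] :
    ringKrullDim (A ⧸ nilradical A) = ringKrullDim A := by
  rw [ringKrullDim_quotient, ringKrullDim, PrimeSpectrum.zeroLocus_nilradical]
  exact Order.krullDim_eq_of_orderIso OrderIso.Set.univ

variable {s n : ℕ} {f : MvPolynomial (Fin s) K}

/-- On an integral closed subscheme of the jet scheme on which `∂_k f ≠ 0`, all functions are
algebraic over the coordinates `x_i^{(j)}`, `i ≠ k`. -/
lemma isAlgebraic_of_pderiv_ne_zero {B : Type*} [CommRing B] [IsDomain B] [Algebra K B]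
    (φ : MvPolynomial (Fin s × Fin (n + 1)) K →ₐ[K] B) (hsurj : Function.Surjective φ)
    (hφ : ∀ j : Fin (n + 1), φ (jetCoeff n j f) = 0)
    {k : Fin s} (hk : φ (jetCoeff n 0 (pderiv k f)) ≠ 0) :
    Algebra.IsAlgebraic (Algebra.adjoin K ((fun ij => φ (X ij)) '' {ij | ij.1 ≠ k})) B := by
  set T := Algebra.adjoin K ((fun ij => φ (X ij)) '' {ij | ij.1 ≠ k}) with hT
  let Z : Subalgebra K B := (Subalgebra.algebraicClosure T B).restrictScalars K
  have hZ : ∀ b, b ∈ Z ↔ IsAlgebraic T b := fun b => Iff.rfl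
  have hne : ∀ j i, i ≠ k → φ (X (i, j)) ∈ T := fun j i hi => Algebra.subset_adjoin ⟨(i, j), hi, rfl⟩
  have hTZ : ∀ b ∈ T, b ∈ Z := fun b hb => (hZ b).2 (isAlgebraic_algebraMap (⟨b, hb⟩ : T))
  have main : ∀ (j : ℕ) (hj : j < n + 1) (i : Fin s), φ (X (i, ⟨j, hj⟩)) ∈ Z := by
    intro j
    induction j using Nat.strong_induction_on with
    | _ j ih =>
    intro hj i
    by_cases hi : i = k
    swap
    · exact hTZ _ (hne _ _ hi)
    subst hi
    rcases Nat.eq_zero_or_pos j with rfl | hpos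
    -- The value 0 in slot `i` is a dummy: `restrictLine` puts the polynomial variable there.
    · let x : Fin s → T := fun i' => if h : i' = i then 0 else ⟨φ (X (i', 0)), hne 0 i' h⟩
      have haeval : ∀ h : MvPolynomial (Fin s) K,
          Polynomial.aeval (φ (X (i, 0))) (restrictLine (K := K) x i h) = φ (jetCoeff n 0 h) := by
        intro h
        rw [aeval_restrictLine, jetCoeff_zero_left, ← AlgHom.comp_apply]
        congr 1
        ext i'
        by_cases h : i' = i
        · subst h; simp
        · simp only [aeval_X, Function.update_of_ne h, AlgHom.comp_apply, rename_X, x, dif_neg h]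
          rfl
      -- The restricted polynomial is nonzero because its derivative takes the nonzero value `∂_k
      -- f`.
      refine (hZ _).2 ⟨restrictLine (K := K) x i f, fun h0 => hk ?_, ?_⟩
      · rw [← haeval, ← derivative_restrictLine, h0, Polynomial.derivative_zero, map_zero]
      · rw [← hφ 0]
        exact haeval f
    · have hadj : ∀ h ∈ Algebra.adjoin K (precedingVars K n i j), φ h ∈ Z := by
        intro h hh
        have hle : Algebra.adjoin K (precedingVars K n i j) ≤ Z.comap φ := by
          rw [Algebra.adjoin_le_iff]
          rintro _ ⟨⟨i', l⟩, hl | hl, rfl⟩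
          · exact ih l hl l.2 i'
          · exact hTZ _ (hne l i' hl.2)
        exact hle hh
      have hD := hadj _
        (jetCoeff_mem_adjoin_precedingVars n i hpos (Nat.lt_succ_iff.1 hj) (pderiv i f))
      have hG := hadj _ (jetCoeff_sub_mem n i ⟨j, hj⟩ (by simp [Fin.ext_iff, hpos.ne']) f)
      rw [map_sub, hφ, zero_sub, neg_mem_iff, map_mul] at hG
      exact IsAlgebraic.of_mul (mem_nonZeroDivisors_of_ne_zero hk) hD hG
  refine ⟨fun b => ?_⟩
  obtain ⟨P, rfl⟩ := hsurj b
  rw [← hZ]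
  have htop : Algebra.adjoin K (Set.range X) ≤ Z.comap φ := by
    rw [Algebra.adjoin_le_iff]
    rintro _ ⟨ij, rfl⟩
    exact main ij.2 ij.2.2 ij.1
  rw [adjoin_range_X] at htop
  exact htop (Algebra.mem_top)

/-- An irreducible jet scheme that contains a jet over a smooth point of the hypersurface has at
most the expected dimension. -/
lemma ringKrullDim_le_of_pderiv_not_nilpotent {R : Type*} [CommRing R] [Algebra K R]
    {ψ : MvPolynomial (Fin s × Fin (n + 1)) K →ₐ[K] R} (hψ : Function.Surjective ψ)
    (hψf : ∀ j : Fin (n + 1), ψ (jetCoeff n j f) = 0) (hR : (nilradical R).IsPrime)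
    {k : Fin s} (hk : ¬ IsNilpotent (ψ (jetCoeff n 0 (pderiv k f)))) :
    ringKrullDim R ≤ ((s - 1) * (n + 1) : ℕ) := by
  classical
  let φ : MvPolynomial (Fin s × Fin (n + 1)) K →ₐ[K] R ⧸ nilradical R :=
    (Ideal.Quotient.mkₐ K _).comp ψ
  have hsurj : Function.Surjective φ := Ideal.Quotient.mk_surjective.comp hψ
  have : Algebra.FiniteType K (R ⧸ nilradical R) := Algebra.FiniteType.of_surjective φ hsurj
  let t : Finset (R ⧸ nilradical R) :=
    (Finset.univ.filter fun ij : Fin s × Fin (n + 1) => ij.1 ≠ k).image fun ij => φ (X ij)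
  have ht : (t : Set (R ⧸ nilradical R)) = (fun ij => φ (X ij)) '' {ij | ij.1 ≠ k} := by
    simp [t]
  have : Algebra.IsAlgebraic (Algebra.adjoin K (t : Set (R ⧸ nilradical R))) (R ⧸ nilradical R) := by
    rw [ht]
    refine isAlgebraic_of_pderiv_ne_zero (f := f) φ hsurj (fun j => ?_) fun h => hk ?_
    · simp [φ, hψf]
    · exact mem_nilradical.1 (Ideal.Quotient.eq_zero_iff_mem.1 h)
  rw [← ringKrullDim_quotient_nilradical]
  refine (ringKrullDim_le_card (K := K) t).trans ?_
  have hcard : t.card ≤ (s - 1) * (n + 1) := by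
    refine Finset.card_image_le.trans (le_of_eq ?_)
    have : (Finset.univ.filter fun ij : Fin s × Fin (n + 1) => ij.1 ≠ k) =
        (Finset.univ.erase k) ×ˢ Finset.univ := by
      ext ij; simp
    rw [this, Finset.card_product, Finset.card_erase_of_mem (Finset.mem_univ k)]
    simp
  exact_mod_cast hcard

end Dimension

/-! ### Tangent vectors and local equations -/

section TangentVectors

variable {K : Type*} [Field K]

/-- The local equations of the maximal ideal at a prime, without denominators. -/
lemma exists_fun_spanFinrank_maximalIdeal {R : Type*} [CommRing R] [IsNoetherianRing R]
    (q : Ideal R) [q.IsPrime] :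
    ∃ g : Fin (IsLocalRing.maximalIdeal (Localization.AtPrime q)).spanFinrank → R,
      (∀ i, g i ∈ q) ∧ ∀ h ∈ q, ∃ u ∉ q, u * h ∈ Ideal.span (Set.range g) := by
  have : IsNoetherianRing (Localization.AtPrime q) :=
    IsLocalization.isNoetherianRing q.primeCompl _ inferInstance
  obtain ⟨t, ht, hspan⟩ := Submodule.FG.exists_span_finset_card_eq_spanFinrank
    (IsLocalRing.maximalIdeal (Localization.AtPrime q)).fg_of_isNoetherianRing
  obtain ⟨y, hy⟩ : ∃ y : Fin (IsLocalRing.maximalIdeal (Localization.AtPrime q)).spanFinrank →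
      Localization.AtPrime q, Ideal.span (Set.range y) = IsLocalRing.maximalIdeal _ := by
    refine ⟨fun i => (t.equivFinOfCardEq ht).symm i, Eq.trans (congrArg _ ?_) hspan⟩
    ext z
    constructor
    · rintro ⟨i, rfl⟩; exact Subtype.prop _
    · intro hz; exact ⟨t.equivFinOfCardEq ht ⟨z, hz⟩, by simp⟩
  -- Denominators are units of the localization, so the numerators generate the same ideal there.
  choose g w hgw using fun i => IsLocalization.exists_mk'_eq q.primeCompl (y i)
  have hg : ∀ i, algebraMap R (Localization.AtPrime q) (g i) =
      algebraMap R (Localization.AtPrime q) (w i) * y i := fun i => by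
    rw [← hgw i, mul_comm, IsLocalization.mk'_spec]
  have hyi : ∀ i, y i ∈ IsLocalRing.maximalIdeal (Localization.AtPrime q) := fun i => by
    rw [← hy]; exact Submodule.subset_span ⟨i, rfl⟩
  refine ⟨g, fun i => ?_, fun h hh => ?_⟩
  · rw [← IsLocalization.AtPrime.to_map_mem_maximal_iff (Localization.AtPrime q) q, hg]
    exact Ideal.mul_mem_left _ _ (hyi i)
  · have h1 : algebraMap R (Localization.AtPrime q) h ∈
        (Ideal.span (Set.range g)).map (algebraMap R (Localization.AtPrime q)) := by
      have h2 := (IsLocalization.AtPrime.to_map_mem_maximal_iff (Localization.AtPrime q) q h).2 hh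
      rw [← hy] at h2
      refine Ideal.span_le.2 ?_ h2
      rintro _ ⟨i, rfl⟩
      have hu := IsLocalization.map_units (Localization.AtPrime q) (w i)
      refine (Ideal.unit_mul_mem_iff_mem _ hu).1 ?_
      rw [← hg]
      exact Ideal.mem_map_of_mem _ (Ideal.subset_span ⟨i, rfl⟩)
    rw [IsLocalization.algebraMap_mem_map_algebraMap_iff q.primeCompl] at h1
    obtain ⟨u, hu, hmem⟩ := h1
    exact ⟨u, hu, hmem⟩

variable {σ : Type*} [Fintype σ] (a : σ → K)

/-- The derivative at `a` in the direction of a vector. -/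
def dirDeriv : (σ → K) →ₗ[K] MvPolynomial σ K →ₗ[K] K where
  toFun v := ∑ i, v i • (aeval a).toLinearMap ∘ₗ (pderiv i).toLinearMap
  map_add' v w := by simp [add_smul, Finset.sum_add_distrib]
  map_smul' c v := by simp [mul_smul, Finset.smul_sum]

lemma dirDeriv_apply (v : σ → K) (P : MvPolynomial σ K) :
    dirDeriv a v P = ∑ i, v i * aeval a (pderiv i P) := by
  simp [dirDeriv, LinearMap.sum_apply]

lemma dirDeriv_mul (v : σ → K) (P Q : MvPolynomial σ K) :
    dirDeriv a v (P * Q) = aeval a P * dirDeriv a v Q + aeval a Q * dirDeriv a v P := by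
  simp only [dirDeriv_apply, Derivation.leibniz, smul_eq_mul, map_add, map_mul, mul_add,
    Finset.sum_add_distrib, Finset.mul_sum]
  congr 1 <;> exact Finset.sum_congr rfl fun i _ => by ring

lemma dirDeriv_X_sub_C (v : σ → K) (i : σ) (c : K) : dirDeriv a v (X i - C c) = v i := by
  classical
  rw [dirDeriv_apply, Finset.sum_eq_single i]
  · simp
  · intro j _ hj
    rw [map_sub, pderiv_X_of_ne hj.symm]
    simp
  · simp

/-- A tangent vector that is annihilated by local equations of a point vanishes. -/
lemma eq_zero_of_dirDeriv_eq_zero {ι : Type*} {G : ι → MvPolynomial σ K}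
    (hG : ∀ i, aeval a (G i) = 0)
    (hloc : ∀ h, aeval a h = 0 → ∃ u, aeval a u ≠ 0 ∧ u * h ∈ Ideal.span (Set.range G))
    {v : σ → K} (hv : ∀ i, dirDeriv a v (G i) = 0) : v = 0 := by
  have key : ∀ P ∈ Ideal.span (Set.range G), aeval a P = 0 ∧ dirDeriv a v P = 0 := by
    intro P hP
    induction hP using Submodule.span_induction with
    | mem P hP => obtain ⟨i, rfl⟩ := hP; exact ⟨hG i, hv i⟩
    | zero => simp
    | add P Q _ _ hP hQ => exact ⟨by rw [map_add, hP.1, hQ.1, add_zero],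
        by rw [map_add, hP.2, hQ.2, add_zero]⟩
    | smul u P _ hP => rw [smul_eq_mul, map_mul, dirDeriv_mul, hP.1, hP.2]; simp
  funext i
  have h0 : aeval a (X i - C (a i)) = 0 := by simp
  obtain ⟨u, hu, hmem⟩ := hloc _ h0
  have := (key _ hmem).2
  rw [dirDeriv_mul, h0, zero_mul, add_zero, dirDeriv_X_sub_C] at this
  exact (mul_eq_zero.1 this).resolve_left hu

end TangentVectors

/-! ### Jets over the singular locus -/

section SingularPoints

variable {K : Type*} [Field K] {s n : ℕ} {f : MvPolynomial (Fin s) K}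
  {R : Type*} [CommRing R] [Algebra K R]
  {ψ : MvPolynomial (Fin s × Fin (n + 1)) K →ₐ[K] R} (p : R →ₐ[K] K)

/-- The coefficient of order 0 involves only the variables `x_i^{(0)}`. Hence over a singular point
the equation `F_0` imposes no linear condition on tangent vectors. -/
lemma dirDeriv_jetCoeff_zero {a v : Fin s × Fin (n + 1) → K} {g : MvPolynomial (Fin s) K}
    (hg : ∀ k, aeval a (jetCoeff n 0 (pderiv k g)) = 0) : dirDeriv a v (jetCoeff n 0 g) = 0 := by
  have hinj : Function.Injective fun i : Fin s => (i, (0 : Fin (n + 1))) :=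
    fun i j h => congrArg Prod.fst h
  rw [dirDeriv_apply]
  refine Finset.sum_eq_zero fun ij _ => ?_
  rw [jetCoeff_zero_left]
  by_cases hj : ij.2 = 0
  · obtain ⟨i, j⟩ := ij
    subst hj
    have := hg i
    rw [jetCoeff_zero_left] at this
    rw [pderiv_rename hinj, this, mul_zero]
  · rw [pderiv_eq_zero_of_notMem_vars, map_zero, mul_zero]
    intro hmem
    classical
    obtain ⟨i, _, hi⟩ := Finset.mem_image.1 (vars_rename _ _ hmem)
    exact hj (by rw [← hi])

/-- The embedding dimension of the jet scheme at a jet over a singular point of the hypersurface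
exceeds the expected dimension. -/
lemma card_le_spanFinrank_add (hψ : Function.Surjective ψ) (hker : RingHom.ker ψ = jetIdeal f n)
    [(RingHom.ker p).IsPrime] (hsing : ∀ k, p (ψ (jetCoeff n 0 (pderiv k f))) = 0) :
    s * (n + 1) ≤
      (IsLocalRing.maximalIdeal (Localization.AtPrime (RingHom.ker p))).spanFinrank + n := by
  have : IsNoetherianRing R := isNoetherianRing_of_surjective _ _ ψ.toRingHom hψ
  obtain ⟨g, hg, hloc⟩ := exists_fun_spanFinrank_maximalIdeal (RingHom.ker p)
  choose G hG using fun i => hψ (g i)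
  set a := coords ψ p with ha
  -- The differentials of lifted local equations of `p` and of `F_1, …, F_n`. A common zero is also
  -- killed by `F_0`, so it vanishes, and counting dimensions gives the bound.
  let L : (Fin s × Fin (n + 1) → K) →ₗ[K]
      ((Fin (IsLocalRing.maximalIdeal (Localization.AtPrime (RingHom.ker p))).spanFinrank ⊕ Fin n)
        → K) :=
    LinearMap.pi fun i => (dirDeriv a).flip (Sum.elim G (fun j : Fin n => jetCoeff n (j + 1) f) i)
  have hL : Function.Injective L := by
    rw [injective_iff_map_eq_zero]
    intro v hv
    have hv' : ∀ i, dirDeriv a v (Sum.elim G (fun j : Fin n => jetCoeff n (j + 1) f) i) = 0 :=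
      fun i => by
        have := congrFun hv i
        simpa only [L, LinearMap.pi_apply, LinearMap.flip_apply, Pi.zero_apply] using this
    refine eq_zero_of_dirDeriv_eq_zero a
      (G := Sum.elim G fun j : Fin (n + 1) => jetCoeff n j f) ?_ ?_ ?_
    · rintro (i | j)
      · rw [Sum.elim_inl, aeval_coords, hG]; exact hg i
      · rw [Sum.elim_inr, aeval_coords]
        have : jetCoeff n j f ∈ RingHom.ker ψ := hker ▸ Ideal.subset_span ⟨j, rfl⟩
        rw [RingHom.mem_ker.1 this, map_zero]
    · intro h hh
      rw [aeval_coords] at hh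
      obtain ⟨u, hu, hmem⟩ := hloc (ψ h) hh
      obtain ⟨U, rfl⟩ := hψ u
      refine ⟨U, by rw [aeval_coords]; exact hu, ?_⟩
      have hmap : ψ (U * h) ∈ (Ideal.span (Set.range G)).map ψ := by
        rw [map_mul, Ideal.map_span, ← Set.range_comp]
        convert hmem using 3
        funext i
        exact hG i
      rw [Set.Sum.elim_range, Ideal.span_union, ← jetIdeal, ← hker]
      obtain ⟨P, hP, hPU⟩ := (Ideal.mem_map_iff_of_surjective ψ hψ).1 hmap
      rw [← add_sub_cancel P (U * h)]
      exact Submodule.add_mem_sup hP (by rw [RingHom.mem_ker, map_sub, hPU, sub_self])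
    · rintro (i | j)
      · exact hv' (Sum.inl i)
      · refine Fin.cases ?_ (fun j => ?_) j
        · refine dirDeriv_jetCoeff_zero fun k => ?_
          rw [aeval_coords, hsing]
        · exact hv' (Sum.inr j)
  have := LinearMap.finrank_le_finrank_of_injective hL
  simpa using this

/-- The points of an irreducible jet scheme over the singular points of the hypersurface are
singular. -/
theorem not_isNonsingularPoint_of_pderiv_eq_zero (hψ : Function.Surjective ψ)
    (hker : RingHom.ker ψ = jetIdeal f n) (hR : (nilradical R).IsPrime)
    {k : Fin s} (hk : ¬ IsNilpotent (ψ (jetCoeff n 0 (pderiv k f))))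
    (hsing : ∀ k, p (ψ (jetCoeff n 0 (pderiv k f))) = 0) : ¬ IsNonsingularPoint p := by
  intro hreg
  have hp : (RingHom.ker p).IsPrime := RingHom.ker_isPrime p
  have hreg' : IsRegularLocalRing (Localization.AtPrime (RingHom.ker p)) := hreg
  have h1 := hreg'.spanFinrank_maximalIdeal
  rw [IsLocalization.AtPrime.ringKrullDim_eq_height (RingHom.ker p)] at h1
  have h2 := ringKrullDim_le_of_pderiv_not_nilpotent (f := f) hψ (fun j => by
    rw [← RingHom.mem_ker, hker]; exact Ideal.subset_span ⟨j, rfl⟩) hR hk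
  have h3 := h1.le.trans (Ideal.height_le_ringKrullDim_of_isPrime.trans h2)
  have h4 : (IsLocalRing.maximalIdeal (Localization.AtPrime (RingHom.ker p))).spanFinrank ≤
      (s - 1) * (n + 1) := by exact_mod_cast h3
  have h5 := card_le_spanFinrank_add p hψ hker hsing
  obtain ⟨t, rfl⟩ : ∃ t, s = t + 1 := ⟨s - 1, by have := k.2; omega⟩
  rw [Nat.add_sub_cancel] at h4
  rw [add_mul] at h5
  omega

end SingularPoints

end JetJac

end

/-- A `K`-point of `J_n(V(f)) = Spec (HS^n_{A/K})`, where `A = K[x_1, …, x_s]/⟨f⟩`, is a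
`K`-algebra homomorphism `p : HS^n_{A/K} → K`; its coordinates in affine space of dimension
`s(n+1)` are the values `p (d_j(x_i))`. -/
theorem mainTheorem9 {K : Type*} [Field K] [IsAlgClosed K] (s n m : ℕ) (hm : 1 ≤ m)
    (f : MvPolynomial (Fin s) K) (hf : Irreducible f)
    (hJ : IrreducibleSpace (PrimeSpectrum (JetJac.JetRing f n)))
    (p : JetJac.JetRing f n →ₐ[K] K) :
    JetJac.IsNonsingularPoint p ↔
      ((JetJac.jetHigherJac f n m).map p).rank = (n + 1) * (m + s - 1).choose s := by
  obtain ⟨k, hk⟩ := JetJac.exists_not_dvd_pderiv hf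
  have hs : 0 < s := k.pos
  have hbase : ∀ g : MvPolynomial (Fin s) K,
      p (JetJac.jetPres f n (JetJac.jetCoeff n 0 g)) = JetJac.baseEval p g := fun g => by
    rw [JetJac.jetPres_jetCoeff f n (Nat.zero_le n), JetJac.baseEval_apply]
  rw [JetJac.rank_jetHigherJac_eq_iff p hs hm]
  constructor
  · intro hreg
    by_contra! hsing
    refine JetJac.not_isNonsingularPoint_of_pderiv_eq_zero p (JetJac.jetPres_surjective f n)
      (JetJac.ker_jetPres f n) (PrimeSpectrum.irreducibleSpace_iff_isPrime_nilradical.1 hJ)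
      (k := k) (fun hnil => ?_) (fun i => (hbase _).trans (hsing i)) hreg
    have hprime : (Ideal.span {f}).IsPrime :=
      (Ideal.span_singleton_prime hf.ne_zero).2 hf.prime
    rw [JetJac.jetPres_jetCoeff f n (Nat.zero_le n)] at hnil
    -- Constant jets carry nilpotency back to the coordinate ring of `X`, a domain, where it would
    -- force `f ∣ ∂_k f`.
    have hnil' := hnil.map (JetJac.constJet K n)
    rw [JetJac.constJet_hsd_zero] at hnil'
    exact hk (Ideal.mem_span_singleton.1 (Ideal.Quotient.eq_zero_iff_mem.1 hnil'.eq_zero))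
  · rintro ⟨i, hi⟩
    exact JetJac.isNonsingularPoint_of_pderiv_ne_zero p (JetJac.jetPres_surjective f n)
      (JetJac.ker_jetPres f n) ((hbase _).trans_ne hi)
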